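/- Let $X$ be a real Hilbert space, let $S\subseteq X$ be nonempty, and let $T\colon S\to X$ be nonexpansive, i.e. $\|Tx-Ty\|\le\|x-y\|$ for all $x,y\in S$. Operators $B\colon X\rightrightarrows X$ are set-valued, with graph $\operatorname{gra}B=\{(x,x^*)\in X\times X : x^*\in Bx\}$; sums, differences, scalar multiples and inverses are those of set-valued operators, and a mapping defined on a subset of $X$ is regarded as a set-valued operator with empty values elsewhere. Proceed as follows. 1. Set $F:=\tfrac12\mathrm{Id}+\tfrac12T\colon S\to X$. 2. Set $A:=F^{-1}-\mathrm{Id}\colon X\rightrightarrows X$. 3. For $(x,x^*)\in X\times X$ set $$\Phi_A(x,x^*):=\sup_{(a,a^*)\in\operatorname{gra}A}\big(\langle x,a^*\rangle+\langle a,x^*\rangle-\langle a,a^*\rangle\big),\qquad \Phi_A^*(y^*,y):=\sup_{(x,x^*)\in X\times X}\big(\langle x,y^*\rangle+\langle y,x^*\rangle-\Phi_A(x,x^*)\big),$$ $$\Psi_A(x,x^*):=\inf_{(x,x^*)=\frac12(y+z,\,y^*+z^*)}\Big(\tfrac12\Phi_A(y,y^*)+\tfrac12\Phi_A^*(z^*,z)+\tfrac18\big(\|y-z\|^2+\|y^*-z^*\|^2\big)\Big),$$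 with values in $[-\infty,+\infty]$, and define $\widetilde A\colon X\rightrightarrows X$ by $$x^*\in\widetilde Ax\iff (x^*,x)\in\partial\Psi_A(x,x^*),$$ where $\partial$ is the subdifferential of convex analysis on the Hilbert space $X\times X$ (empty at points where the function is not finite). 4. Set $\widetilde F:=(\mathrm{Id}+\widetilde A)^{-1}$. 5. Set $\widetilde T:=2\widetilde F-\mathrm{Id}$. Then the infimum defining $\Psi_A$ is a minimum at every point of $X\times X$, and $\widetilde T$ is single-valued with full domain: it is a mapping $\widetilde T\colon X\to X$. This mapping is nonexpansive and $\widetilde T|_S=T$. -/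

import Mathlib

namespace KirszbraunExt

noncomputable section

/-- Set-valued operators from `X` to the power set of `X`. -/
abbrev SetOp (X : Type*) := X → Set X

/-- The graph `{(x, x') | x' ∈ A x}`. -/
def gra {X : Type*} (A : SetOp X) : Set (X × X) := {p | p.2 ∈ A p.1}

/-- The inverse operator: `x ∈ A⁻¹ u` iff `u ∈ A x`. -/
def SetOp.inv {X : Type*} (A : SetOp X) : SetOp X := fun u => {x | u ∈ A x}

/-- The identity, as a set-valued operator. -/
def SetOp.id (X : Type*) : SetOp X := fun x => {x}

/-- A single-valued mapping `T : S → X`, `S ⊆ X`, as a set-valued operator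
(with empty values outside `S`). -/
def SetOp.ofMap {X : Type*} {S : Set X} (T : S → X) : SetOp X :=
  fun x => {u | ∃ h : x ∈ S, u = T ⟨x, h⟩}

/-- Pointwise (Minkowski) sum of operators. -/
def SetOp.add {X : Type*} [AddCommGroup X] (A B : SetOp X) : SetOp X :=
  fun x => {u | ∃ a ∈ A x, ∃ b ∈ B x, u = a + b}

/-- Pointwise (Minkowski) difference of operators. -/
def SetOp.sub {X : Type*} [AddCommGroup X] (A B : SetOp X) : SetOp X :=
  fun x => {u | ∃ a ∈ A x, ∃ b ∈ B x, u = a - b}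

/-- Pointwise scalar multiple of an operator. -/
def SetOp.smul {X : Type*} [AddCommGroup X] [Module ℝ X] (c : ℝ) (A : SetOp X) : SetOp X :=
  fun x => {u | ∃ a ∈ A x, u = c • a}

variable {X : Type*} [NormedAddCommGroup X] [InnerProductSpace ℝ X]

/-- The Hilbert inner product of `X × X`: `⟨(u, v), (x, y)⟩ = ⟨u, x⟩ + ⟨v, y⟩`. -/
def pairing (p q : X × X) : ℝ := inner ℝ p.1 q.1 + inner ℝ p.2 q.2

/-- The squared Hilbert norm of `X × X` (Mathlib's norm on `X × X` is the sup norm). -/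
def sqNorm (p : X × X) : ℝ := ‖p.1‖ ^ 2 + ‖p.2‖ ^ 2

/-- The Fenchel conjugate of an extended-real function on the Hilbert space `X × X`. -/
def conjugate (f : X × X → EReal) (u : X × X) : EReal :=
  ⨆ p : X × X, ((pairing p u : ℝ) : EReal) - f p

/-- The convex subdifferential of an extended-real function on the Hilbert space `X × X`;
it is empty where the function is not finite. -/
def subdifferential (f : X × X → EReal) (p : X × X) : Set (X × X) :=
  {u | f p ≠ ⊥ ∧ f p ≠ ⊤ ∧ ∀ q : X × X, f p + ((pairing u (q - p) : ℝ) : EReal) ≤ f q}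

/-- The values over which the minimum in the proximal average of `f` and `g` at `w` is taken. -/
def proxAverageValues (f g : X × X → EReal) (w : X × X) : Set EReal :=
  {r | ∃ p q : X × X, w = (1 / 2 : ℝ) • (p + q) ∧
    r = ((1 / 2 : ℝ) : EReal) * f p + ((1 / 2 : ℝ) : EReal) * g q
      + (((1 / 8 : ℝ) * sqNorm (p - q) : ℝ) : EReal)}

/-- The proximal average of `f` and `g`. -/
def proxAverage (f g : X × X → EReal) (w : X × X) : EReal :=
  sInf (proxAverageValues f g w)

/-- The Fitzpatrick function
`Φ_A (x, x') = sup_{(a, a') ∈ gra A} (⟨x, a'⟩ + ⟨a, x'⟩ - ⟨a, a'⟩)`. -/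
def fitzpatrick (A : SetOp X) (p : X × X) : EReal :=
  ⨆ a ∈ gra A, ((inner ℝ p.1 a.2 + inner ℝ a.1 p.2 - inner ℝ a.1 a.2 : ℝ) : EReal)

/-- The transposed conjugate of the Fitzpatrick function, `(z, z') ↦ Φ_A^* (z', z)`. -/
def fitzpatrickConjT (A : SetOp X) (q : X × X) : EReal :=
  conjugate (fitzpatrick A) q.swap

/-- `Ψ_A`, the proximal average of `Φ_A` and its transposed conjugate. -/
def psi (A : SetOp X) : X × X → EReal :=
  proxAverage (fitzpatrick A) (fitzpatrickConjT A)

/-- The operator `Ã`, with `x' ∈ Ã x` iff `(x', x) ∈ ∂ Ψ_A (x, x')`. -/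
def tildeOp (A : SetOp X) : SetOp X :=
  fun x => {x' | (x', x) ∈ subdifferential (psi A) (x, x')}

/-- Step 1: `F = ½ Id + ½ T` on `S`. -/
def stepF {S : Set X} (T : S → X) : S → X :=
  fun s => (1 / 2 : ℝ) • (s : X) + (1 / 2 : ℝ) • T s

/-- Step 2: `A = F⁻¹ - Id`. -/
def stepA {S : Set X} (T : S → X) : SetOp X :=
  SetOp.sub (SetOp.inv (SetOp.ofMap (stepF T))) (SetOp.id X)

/-- Steps 3 and 4: `F̃ = (Id + Ã)⁻¹`. -/
def stepFTilde {S : Set X} (T : S → X) : SetOp X :=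
  SetOp.inv (SetOp.add (SetOp.id X) (tildeOp (stepA T)))

/-- Step 5: `T̃ = 2 F̃ - Id`. -/
def stepTTilde {S : Set X} (T : S → X) : SetOp X :=
  SetOp.sub (SetOp.smul 2 (stepFTilde T)) (SetOp.id X)

end

end KirszbraunExt

/-!
Write `J` for the swap of `X × X`, `f` for the Fitzpatrick function of the monotone operator
`A = F⁻¹ - Id`, and `g = f* ∘ J` for its transposed conjugate, so that `Ψ_A` is the proximal average
of `f` and `g`. Everything rests on proximal points: `y` is the proximal point of `f` at `v` when
`v - y ∈ ∂f(y)`.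

* Proximal points of a proper supremum of affine functions exist at every `v`
  (`exists_prox`, `exists_subgradient`). The infimum which defines `Ψ_A(w)` is itself
  a proximal point problem at `w`, for the function `y ↦ ½ f(y) + ½ g(2w - y)`, hence it is attained
  (`isLeast_proxAverageValues`).
* The proximal mapping of a proximal average is the average of the proximal mappings
  (`sub_mem_subdifferential_proxAverage`).
* Moreau's decomposition, in the form that `u ∈ ∂f(y)` implies `J y ∈ ∂g(J u)`
  (`swap_mem_subdifferential_conjT`): if `y` is the proximal point of `f` at `v` and `J v = v`,
  then `z = v - J y` is the proximal point of `g` at `v`.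

Consequently `w = ½ (y + z)` satisfies `w + J w = v` and `v - w = J w ∈ ∂Ψ_A(w)`, that is,
`w` is in the graph of `Ã` (`mem_tildeOp_average`). With `v = (u, u)` this says that the
components of `w` add up to `u`, so `Id + Ã` is surjective. With `w ∈ gra A` and `v = w + J w` one
has `y = z = w`, so `Ã` extends `A`. Finally `Ã` is monotone, because subdifferentials are;
this makes `(Id + Ã)⁻¹` single-valued and firmly nonexpansive, and its reflection `T̃` nonexpansive.
-/

namespace KirszbraunExt

open Filter Topology

/-! ### The Hilbert structure of `X × X` -/

variable {X : Type*} [NormedAddCommGroup X]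

lemma sqNorm_nonneg (p : X × X) : 0 ≤ sqNorm p := by
  unfold sqNorm; positivity

lemma norm_sq_le_sqNorm (p : X × X) : ‖p‖ ^ 2 ≤ sqNorm p := by
  unfold sqNorm
  rcases max_choice ‖p.1‖ ‖p.2‖ with h | h <;> rw [Prod.norm_def, h] <;>
    nlinarith [sq_nonneg ‖p.1‖, sq_nonneg ‖p.2‖]

lemma continuous_sqNorm : Continuous (sqNorm : X × X → ℝ) := by
  unfold sqNorm; fun_prop

variable [InnerProductSpace ℝ X]

lemma pairing_comm (p q : X × X) : pairing p q = pairing q p := by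
  simp only [pairing, real_inner_comm]

lemma pairing_add_left (p q r : X × X) : pairing (p + q) r = pairing p r + pairing q r := by
  simp only [pairing, Prod.fst_add, Prod.snd_add, inner_add_left]; ring

lemma pairing_sub_left (p q r : X × X) : pairing (p - q) r = pairing p r - pairing q r := by
  simp only [pairing, Prod.fst_sub, Prod.snd_sub, inner_sub_left]; ring

lemma pairing_smul_left (c : ℝ) (p r : X × X) : pairing (c • p) r = c * pairing p r := by
  simp only [pairing, Prod.smul_fst, Prod.smul_snd, real_inner_smul_left]; ring

lemma pairing_add_right (p q r : X × X) : pairing r (p + q) = pairing r p + pairing r q := by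
  simp only [pairing_comm r, pairing_add_left]

lemma pairing_sub_right (p q r : X × X) : pairing r (p - q) = pairing r p - pairing r q := by
  simp only [pairing_comm r, pairing_sub_left]

lemma pairing_smul_right (c : ℝ) (p r : X × X) : pairing r (c • p) = c * pairing r p := by
  simp only [pairing_comm r, pairing_smul_left]

lemma pairing_swap_swap (p q : X × X) : pairing p.swap q.swap = pairing p q := by
  simp only [pairing, Prod.fst_swap, Prod.snd_swap, add_comm]

lemma sqNorm_eq (p : X × X) : sqNorm p = pairing p p := by
  simp only [sqNorm, pairing, real_inner_self_eq_norm_sq]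

lemma continuous_pairing_right (c : X × X) : Continuous fun p : X × X => pairing p c := by
  unfold pairing; fun_prop

/-! ### Proximal points of suprema of affine functions -/

/-- The epigraph of the supremum of the affine functions `p ↦ ⟨p, c⟩ - t`, `(c, t) ∈ C`. -/
def affineEpi (C : Set ((X × X) × ℝ)) : Set ((X × X) × ℝ) :=
  {e | ∀ c ∈ C, pairing e.1 c.1 - c.2 ≤ e.2}

lemma affineEpi_convex {C : Set ((X × X) × ℝ)} {p q : X × X} {r s t : ℝ}
    (hp : (p, r) ∈ affineEpi C) (hq : (q, s) ∈ affineEpi C) (h0 : 0 ≤ t) (h1 : t ≤ 1) :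
    (p + t • (q - p), r + t * (s - r)) ∈ affineEpi C := by
  intro c hc
  have h2 := hp c hc
  have h3 := hq c hc
  simp only [pairing_add_left, pairing_smul_left, pairing_sub_left] at h2 h3 ⊢
  nlinarith [mul_le_mul_of_nonneg_left h3 h0, mul_le_mul_of_nonneg_left h2 (sub_nonneg.2 h1)]

/-- Minimizing sequences of a strongly convex problem are Cauchy, by the parallelogram law; the
limit is a minimizer because the epigraph is closed. -/
lemma exists_prox [CompleteSpace X] {C : Set ((X × X) × ℝ)} (hC : C.Nonempty)
    (hE : (affineEpi C).Nonempty) (v : X × X) :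
    ∃ (y : X × X) (a : ℝ), (y, a) ∈ affineEpi C ∧ ∀ (q : X × X) (s : ℝ), (q, s) ∈ affineEpi C →
      a + 1 / 2 * sqNorm (y - v) ≤ s + 1 / 2 * sqNorm (q - v) := by
  set V : Set ℝ := (fun e : (X × X) × ℝ => e.2 + 1 / 2 * sqNorm (e.1 - v)) '' affineEpi C
  have hVne : V.Nonempty := hE.image _
  have hVbdd : BddBelow V := by
    obtain ⟨c, hc⟩ := hC
    refine ⟨pairing v c.1 - c.2 - 1 / 2 * pairing c.1 c.1, ?_⟩
    rintro _ ⟨e, he, rfl⟩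
    have h1 := he c hc
    -- Completing the square.
    have h2 := sqNorm_nonneg (e.1 - v + c.1)
    simp only [sqNorm_eq, pairing_add_left, pairing_add_right, pairing_sub_left,
      pairing_sub_right, pairing_comm c.1, pairing_comm v e.1] at h1 h2 ⊢
    linarith
  set m := sInf V
  have hm : ∀ (q : X × X) (s : ℝ), (q, s) ∈ affineEpi C → m ≤ s + 1 / 2 * sqNorm (q - v) :=
    fun q s h => csInf_le hVbdd ⟨(q, s), h, rfl⟩
  have hex : ∀ n : ℕ, ∃ e ∈ affineEpi C,
      e.2 + 1 / 2 * sqNorm (e.1 - v) < m + 1 / ((n : ℝ) + 1) := by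
    intro n
    obtain ⟨_, ⟨e, he, rfl⟩, hlt⟩ := exists_lt_of_csInf_lt hVne
      (lt_add_of_pos_right m (Nat.one_div_pos_of_nat (n := n) (α := ℝ)))
    exact ⟨e, he, hlt⟩
  choose e he hlt using hex
  have hgap : ∀ n k : ℕ, ‖(e n).1 - (e k).1‖ ^ 2 ≤ 4 * (1 / ((n : ℝ) + 1) + 1 / ((k : ℝ) + 1)) := by
    intro n k
    have h1 := hm _ _ (affineEpi_convex (t := 1 / 2) (he n) (he k) (by norm_num) (by norm_num))
    have h2 := hlt n
    have h3 := hlt k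
    refine (norm_sq_le_sqNorm _).trans ?_
    simp only [sqNorm_eq, pairing_add_left, pairing_add_right, pairing_sub_left,
      pairing_sub_right, pairing_smul_left, pairing_smul_right, pairing_comm v,
      pairing_comm (e k).1 (e n).1] at h1 h2 h3 ⊢
    linarith
  have hcauchy : CauchySeq fun n => (e n).1 := by
    rw [Metric.cauchySeq_iff]
    intro ε hε
    obtain ⟨N, hN⟩ := exists_nat_one_div_lt (show (0 : ℝ) < ε ^ 2 / 8 by positivity)
    refine ⟨N, fun n hn k hk => ?_⟩
    have h1 : 1 / ((n : ℝ) + 1) ≤ 1 / ((N : ℝ) + 1) := Nat.one_div_le_one_div hn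
    have h2 : 1 / ((k : ℝ) + 1) ≤ 1 / ((N : ℝ) + 1) := Nat.one_div_le_one_div hk
    rw [dist_eq_norm]
    exact lt_of_pow_lt_pow_left₀ 2 hε.le (by linarith [hgap n k])
  obtain ⟨y, hy⟩ := cauchySeq_tendsto_of_complete hcauchy
  refine ⟨y, m - 1 / 2 * sqNorm (y - v), fun c hc => ?_, fun q s h => by linarith [hm q s h]⟩
  have hl : Tendsto (fun n => pairing (e n).1 c.1 - c.2) atTop (𝓝 (pairing y c.1 - c.2)) :=
    (((continuous_pairing_right c.1).tendsto y).comp hy).sub_const _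
  have hr : Tendsto (fun n : ℕ => m + 1 / ((n : ℝ) + 1) - 1 / 2 * sqNorm ((e n).1 - v)) atTop
      (𝓝 (m + 0 - 1 / 2 * sqNorm (y - v))) :=
    (tendsto_const_nhds.add tendsto_one_div_add_atTop_nhds_zero_nat).sub
      (((continuous_sqNorm.tendsto _).comp (hy.sub_const v)).const_mul _)
  rw [add_zero] at hr
  exact le_of_tendsto_of_tendsto' hl hr fun n => by linarith [he n c hc, hlt n]

/-- The first-order optimality condition of the proximal point problem. -/
lemma exists_subgradient [CompleteSpace X] {C : Set ((X × X) × ℝ)} (hC : C.Nonempty)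
    (hE : (affineEpi C).Nonempty) (v : X × X) :
    ∃ (y : X × X) (a : ℝ), (y, a) ∈ affineEpi C ∧ ∀ (q : X × X) (s : ℝ), (q, s) ∈ affineEpi C →
      a + pairing (v - y) (q - y) ≤ s := by
  obtain ⟨y, a, hya, hmin⟩ := exists_prox hC hE v
  refine ⟨y, a, hya, fun q s hq => ?_⟩
  have key : ∀ t : ℝ, 0 < t → t ≤ 1 →
      a + pairing (v - y) (q - y) - s ≤ t * (1 / 2 * sqNorm (q - y)) := by
    intro t h0 h1
    have h := hmin _ _ (affineEpi_convex hya hq h0.le h1)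
    refine le_of_mul_le_mul_left ?_ h0
    simp only [sqNorm_eq, pairing_add_left, pairing_add_right, pairing_sub_left,
      pairing_sub_right, pairing_smul_left, pairing_smul_right, pairing_comm v,
      pairing_comm q y] at h ⊢
    linarith
  have hlim : Tendsto (fun t : ℝ => t * (1 / 2 * sqNorm (q - y))) (𝓝[>] 0)
      (𝓝 (0 * (1 / 2 * sqNorm (q - y)))) :=
    ((continuous_id.mul continuous_const).tendsto 0).mono_left nhdsWithin_le_nhds
  rw [zero_mul] at hlim
  have := ge_of_tendsto hlim (by
    filter_upwards [Ioc_mem_nhdsGT (zero_lt_one (α := ℝ))] with t ht using key t ht.1 ht.2)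
  linarith

/-! ### Extended-real functions -/

/-- `f` is the supremum of the affine functions `p ↦ ⟨p, c⟩ - t`, `(c, t) ∈ C`. -/
def IsAffineSup (f : X × X → EReal) (C : Set ((X × X) × ℝ)) : Prop :=
  ∀ (p : X × X) (r : ℝ), f p ≤ r ↔ (p, r) ∈ affineEpi C

lemma IsAffineSup.ne_bot {f : X × X → EReal} {C : Set ((X × X) × ℝ)} (hf : IsAffineSup f C)
    (hC : C.Nonempty) (p : X × X) : f p ≠ ⊥ := by
  obtain ⟨c, hc⟩ := hC
  intro h
  have := (hf p (pairing p c.1 - c.2 - 1)).1 (h ▸ bot_le) c hc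
  simp only at this
  linarith

lemma exists_coe_of_le {x : EReal} {r : ℝ} (hb : x ≠ ⊥) (h : x ≤ r) : ∃ a : ℝ, x = a :=
  ⟨x.toReal, (EReal.coe_toReal (fun ht => by simp [ht] at h) hb).symm⟩

lemma coe_sub_le_coe_iff (a b : ℝ) (x : EReal) :
    (a : EReal) - x ≤ b ↔ ∀ r : ℝ, x ≤ r → a - r ≤ b := by
  induction x with
  | bot =>
    simp only [EReal.coe_sub_bot, top_le_iff, EReal.coe_ne_top, bot_le, true_imp_iff, false_iff]
    exact fun h => by linarith [h (a - b - 1)]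
  | coe x =>
    norm_cast
    exact ⟨fun h r hr => by linarith, fun h => h x le_rfl⟩
  | top => simp

lemma mem_subdifferential_iff {f : X × X → EReal} {y u : X × X} :
    u ∈ subdifferential f y ↔ ∃ a : ℝ, f y = a ∧
      ∀ (q : X × X) (s : ℝ), f q ≤ s → a + pairing u (q - y) ≤ s := by
  constructor
  · rintro ⟨h1, h2, h3⟩
    refine ⟨(f y).toReal, (EReal.coe_toReal h2 h1).symm, fun q s hs => ?_⟩
    have := (h3 q).trans hs
    rw [← EReal.coe_toReal h2 h1] at this
    exact_mod_cast this
  · rintro ⟨a, ha, h⟩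
    refine ⟨by simp [ha], by simp [ha], fun q => ?_⟩
    rw [ha, ← EReal.coe_add]
    have hq := h q
    generalize f q = x at hq
    induction x with
    | bot => linarith [hq (a + pairing u (q - y) - 1) bot_le]
    | coe x => exact_mod_cast hq x le_rfl
    | top => exact le_top

lemma subdifferential_monotone {f : X × X → EReal} {p q u v : X × X}
    (hu : u ∈ subdifferential f p) (hv : v ∈ subdifferential f q) :
    0 ≤ pairing (u - v) (p - q) := by
  obtain ⟨a, ha, h1⟩ := mem_subdifferential_iff.1 hu
  obtain ⟨b, hb, h2⟩ := mem_subdifferential_iff.1 hv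
  have h3 := h1 q b hb.le
  have h4 := h2 p a ha.le
  simp only [pairing_sub_left, pairing_sub_right] at h3 h4 ⊢
  linarith

/-! ### The proximal average -/

/-- The objective of the proximal average is `⊤` unless both functions are finite. -/
lemma average_eq_top_or {x y : EReal} (hx : x ≠ ⊥) (hy : y ≠ ⊥) (t : ℝ) :
    ((1 / 2 : ℝ) : EReal) * x + ((1 / 2 : ℝ) : EReal) * y + (t : EReal) = ⊤ ∨
      ∃ a b : ℝ, x = a ∧ y = b := by
  have h : (0 : ℝ) < 1 / 2 := by norm_num
  induction x with
  | bot => exact absurd rfl hx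
  | top =>
    left
    rw [EReal.coe_mul_top_of_pos h]
    induction y with
    | bot => exact absurd rfl hy
    | top => rw [EReal.coe_mul_top_of_pos h]; rfl
    | coe b => rw [← EReal.coe_mul]; rfl
  | coe a =>
    induction y with
    | bot => exact absurd rfl hy
    | top => left; rw [EReal.coe_mul_top_of_pos h, ← EReal.coe_mul]; rfl
    | coe b => exact Or.inr ⟨a, b, rfl, rfl⟩

lemma average_coe (a b t : ℝ) : ((1 / 2 : ℝ) : EReal) * (a : EReal)
    + ((1 / 2 : ℝ) : EReal) * (b : EReal) + (t : EReal)
    = ((1 / 2 * a + 1 / 2 * b + t : ℝ) : EReal) := by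
  push_cast; rfl

/-- Attainment in the proximal average of `f` and `g` at `w`: the constraint leaves `y` free and
sets `z = 2w - y`, and `⅛ ‖y - z‖² = ½ ‖y - w‖²`, so the minimizer is the proximal point at `w` of
the supremum of affine functions `y ↦ ½ f(y) + ½ g(2w - y)`. -/
lemma isLeast_proxAverageValues [CompleteSpace X] {f g : X × X → EReal}
    {C D : Set ((X × X) × ℝ)} (hf : IsAffineSup f C) (hg : IsAffineSup g D)
    (hC : C.Nonempty) (hD : D.Nonempty) (w : X × X) :
    IsLeast (proxAverageValues f g w) (proxAverage f g w) := by
  refine ⟨?_, fun r hr => sInf_le hr⟩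
  suffices h : ∃ r ∈ proxAverageValues f g w, ∀ r' ∈ proxAverageValues f g w, r ≤ r' by
    obtain ⟨r, hr, hmin⟩ := h
    have : proxAverage f g w = r := le_antisymm (sInf_le hr) (le_sInf hmin)
    rwa [this]
  have hww : w = (1 / 2 : ℝ) • (w + w) := by rw [← two_smul ℝ w, smul_smul]; norm_num
  by_cases htop : ∀ r' ∈ proxAverageValues f g w, r' = ⊤
  · have hmem : _ ∈ proxAverageValues f g w := ⟨w, w, hww, rfl⟩
    exact ⟨_, hmem, fun r' hr' => by rw [htop r' hr']; exact le_top⟩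
  push Not at htop
  -- The affine minorants of `y ↦ ½ f(y) + ½ g(2w - y)`.
  set L : Set ((X × X) × ℝ) := {l | ∃ c ∈ C, ∃ d ∈ D,
    l = ((1 / 2 : ℝ) • (c.1 - d.1), 1 / 2 * c.2 + 1 / 2 * d.2 - pairing w d.1)}
  have hLne : L.Nonempty := by
    obtain ⟨c, hc⟩ := hC
    obtain ⟨d, hd⟩ := hD
    exact ⟨_, c, hc, d, hd, rfl⟩
  have hepi : ∀ {p q : X × X} {a b : ℝ}, w = (1 / 2 : ℝ) • (p + q) → f p = a → g q = b →
      (p, 1 / 2 * a + 1 / 2 * b) ∈ affineEpi L := by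
    rintro p q a b hw ha hb _ ⟨c, hc, d, hd, rfl⟩
    have h1 := (hf p a).1 ha.le c hc
    have h2 := (hg q b).1 hb.le d hd
    simp only [hw, pairing_smul_left, pairing_smul_right, pairing_add_left,
      pairing_sub_right] at h1 h2 ⊢
    linarith
  have hsq : ∀ {p q : X × X}, w = (1 / 2 : ℝ) • (p + q) →
      1 / 2 * sqNorm (p - w) = 1 / 8 * sqNorm (p - q) := by
    rintro p q rfl
    simp only [sqNorm_eq, pairing_sub_left, pairing_sub_right, pairing_smul_left,
      pairing_smul_right, pairing_add_left, pairing_add_right, pairing_comm q p]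
    ring
  have hEne : (affineEpi L).Nonempty := by
    obtain ⟨_, ⟨p, q, hw, rfl⟩, hne⟩ := htop
    obtain ⟨a, b, ha, hb⟩ :=
      (average_eq_top_or (hf.ne_bot hC p) (hg.ne_bot hD q) _).resolve_left hne
    exact ⟨_, hepi hw ha hb⟩
  obtain ⟨y, a, hya, hmin⟩ := exists_prox hLne hEne w
  set z : X × X := (2 : ℝ) • w - y with hz
  have hwyz : w = (1 / 2 : ℝ) • (y + z) := by
    rw [hz, add_sub_cancel, smul_smul]; norm_num
  have hpair : ∀ c ∈ C, ∀ d ∈ D,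
      1 / 2 * (pairing y c.1 - c.2) + 1 / 2 * (pairing z d.1 - d.2) ≤ a := by
    intro c hc d hd
    have := hya _ ⟨c, hc, d, hd, rfl⟩
    simp only [hz, pairing_smul_left, pairing_smul_right, pairing_sub_left,
      pairing_sub_right] at this ⊢
    linarith
  obtain ⟨α, hα⟩ : ∃ α : ℝ, f y = α := by
    obtain ⟨d, hd⟩ := hD
    refine exists_coe_of_le (r := 2 * a - (pairing z d.1 - d.2)) (hf.ne_bot hC y)
      ((hf _ _).2 fun c hc => ?_)
    have := hpair c hc d hd
    simp only
    linarith
  have hβ' : g z ≤ ((2 * a - α : ℝ) : EReal) := by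
    refine (hg _ _).2 fun d hd => ?_
    have h1 : f y ≤ ((2 * a - (pairing z d.1 - d.2) : ℝ) : EReal) :=
      (hf _ _).2 fun c hc => by
        have := hpair c hc d hd
        simp only
        linarith
    rw [hα, EReal.coe_le_coe_iff] at h1
    simp only
    linarith
  obtain ⟨β, hβ⟩ := exists_coe_of_le (hg.ne_bot hD z) hβ'
  rw [hβ, EReal.coe_le_coe_iff] at hβ'
  refine ⟨_, ⟨y, z, hwyz, rfl⟩, ?_⟩
  rintro _ ⟨p, q, hw, rfl⟩
  rcases average_eq_top_or (hf.ne_bot hC p) (hg.ne_bot hD q) (1 / 8 * sqNorm (p - q)) with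
    h | ⟨α', β', h1, h2⟩
  · rw [h]; exact le_top
  · rw [h1, h2, hα, hβ, average_coe, average_coe, EReal.coe_le_coe_iff]
    have := hmin _ _ (hepi hw h1 h2)
    rw [hsq hw, hsq hwyz] at this
    linarith

/-- The proximal mapping of a proximal average is the average of the proximal mappings. -/
lemma sub_mem_subdifferential_proxAverage {f g : X × X → EReal} {v y z : X × X}
    (hy : v - y ∈ subdifferential f y) (hz : v - z ∈ subdifferential g z) :
    v - (1 / 2 : ℝ) • (y + z) ∈
      subdifferential (proxAverage f g) ((1 / 2 : ℝ) • (y + z)) := by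
  obtain ⟨a, ha, hf⟩ := mem_subdifferential_iff.1 hy
  obtain ⟨b, hb, hg⟩ := mem_subdifferential_iff.1 hz
  have hfb : ∀ p, f p ≠ ⊥ := fun p h => by
    linarith [hf p (a + pairing (v - y) (p - y) - 1) (h ▸ bot_le)]
  have hgb : ∀ p, g p ≠ ⊥ := fun p h => by
    linarith [hg p (b + pairing (v - z) (p - z) - 1) (h ▸ bot_le)]
  set w := (1 / 2 : ℝ) • (y + z) with hw
  have key : ∀ q, ((1 / 2 * a + 1 / 2 * b + 1 / 8 * sqNorm (y - z) + pairing (v - w) (q - w) : ℝ) :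
      EReal) ≤ proxAverage f g q := by
    intro q
    refine le_sInf ?_
    rintro _ ⟨p₁, p₂, hq, rfl⟩
    rcases average_eq_top_or (hfb p₁) (hgb p₂) (1 / 8 * sqNorm (p₁ - p₂)) with
      h | ⟨a', b', h1, h2⟩
    · rw [h]; exact le_top
    · rw [h1, h2, average_coe, EReal.coe_le_coe_iff]
      have h3 := hf p₁ a' h1.le
      have h4 := hg p₂ b' h2.le
      have h5 := sqNorm_nonneg ((p₁ - y) - (p₂ - z))
      simp only [hq, hw, sqNorm_eq, pairing_sub_left, pairing_sub_right, pairing_smul_left,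
        pairing_smul_right, pairing_add_left, pairing_add_right, pairing_comm v,
        pairing_comm p₁ y, pairing_comm p₁ z, pairing_comm p₂ y, pairing_comm p₂ z,
        pairing_comm p₂ p₁, pairing_comm z y] at h3 h4 h5 ⊢
      linarith
  have hval : proxAverage f g w =
      ((1 / 2 * a + 1 / 2 * b + 1 / 8 * sqNorm (y - z) : ℝ) : EReal) := by
    refine le_antisymm (sInf_le ⟨y, z, hw, ?_⟩) ?_
    · rw [ha, hb, average_coe]
    · have := key w
      rwa [pairing_sub_right, sub_self, add_zero] at this
  refine mem_subdifferential_iff.2 ⟨_, hval, fun q s hs => ?_⟩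
  exact_mod_cast (key q).trans hs

/-! ### The Fitzpatrick function and its transposed conjugate -/

/-- Monotonicity of a set-valued operator. -/
def IsMonotone (A : SetOp X) : Prop :=
  ∀ p ∈ gra A, ∀ q ∈ gra A, 0 ≤ inner ℝ (p.1 - q.1) (p.2 - q.2)

/-- The affine functions whose supremum is the Fitzpatrick function. -/
def fitzpatrickAffine (A : SetOp X) : Set ((X × X) × ℝ) :=
  (fun a : X × X => (a.swap, inner ℝ a.1 a.2)) '' gra A

/-- The affine functions whose supremum is the transposed conjugate of the Fitzpatrick function. -/
def conjTAffine (A : SetOp X) : Set ((X × X) × ℝ) :=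
  {c | fitzpatrick A c.1.swap ≤ (c.2 : EReal)}

lemma isAffineSup_fitzpatrick (A : SetOp X) :
    IsAffineSup (fitzpatrick A) (fitzpatrickAffine A) := by
  intro p r
  simp only [fitzpatrick, iSup_le_iff, EReal.coe_le_coe_iff, affineEpi, fitzpatrickAffine,
    Set.forall_mem_image, Set.mem_ofPred_eq, pairing, Prod.fst_swap, Prod.snd_swap,
    real_inner_comm p.2]

lemma fitzpatrickConjT_le_iff (A : SetOp X) (q : X × X) (s : ℝ) : fitzpatrickConjT A q ≤ s ↔
    ∀ (p : X × X) (r : ℝ), fitzpatrick A p ≤ r → pairing p q.swap - r ≤ s := by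
  simp only [fitzpatrickConjT, conjugate, iSup_le_iff, coe_sub_le_coe_iff]

lemma isAffineSup_conjT (A : SetOp X) : IsAffineSup (fitzpatrickConjT A) (conjTAffine A) := by
  intro q s
  rw [fitzpatrickConjT_le_iff]
  constructor
  · intro h c hc
    have := h c.1.swap c.2 hc
    rwa [pairing_swap_swap, pairing_comm] at this
  · intro h p r hp
    have := h (p.swap, r) (by simpa [conjTAffine] using hp)
    simpa only [← pairing_swap_swap q, Prod.swap_swap, pairing_comm p] using this

lemma IsMonotone.fitzpatrick_eq {A : SetOp X} (hA : IsMonotone A) {a : X × X} (ha : a ∈ gra A) :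
    fitzpatrick A a = ((inner ℝ a.1 a.2 : ℝ) : EReal) := by
  refine le_antisymm (iSup₂_le fun b hb => ?_) ?_
  · have := hA a ha b hb
    simp only [inner_sub_left, inner_sub_right] at this
    exact_mod_cast (by linarith)
  · refine le_of_eq_of_le ?_ (le_iSup₂ a ha)
    norm_cast
    ring

/-- On the graph of a monotone operator, the swap is a selection of the subdifferential of the
Fitzpatrick function. -/
lemma IsMonotone.swap_mem_subdifferential {A : SetOp X} (hA : IsMonotone A) {a : X × X}
    (ha : a ∈ gra A) : a.swap ∈ subdifferential (fitzpatrick A) a := by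
  refine mem_subdifferential_iff.2 ⟨_, hA.fitzpatrick_eq ha, fun q s hs => ?_⟩
  have := (isAffineSup_fitzpatrick A q s).1 hs _ ⟨a, ha, rfl⟩
  rw [pairing_comm] at this
  rw [pairing_sub_right]
  have h2 : pairing a.swap a = 2 * inner ℝ a.1 a.2 := by
    simp only [pairing, Prod.fst_swap, Prod.snd_swap, real_inner_comm a.1]; ring
  simp only at this
  linarith

/-- Moreau's decomposition at the level of subgradients: `u ∈ ∂f(y)` gives `y ∈ ∂f*(u)`. -/
lemma swap_mem_subdifferential_conjT {A : SetOp X} {y u : X × X}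
    (h : u ∈ subdifferential (fitzpatrick A) y) :
    y.swap ∈ subdifferential (fitzpatrickConjT A) u.swap := by
  obtain ⟨a, ha, hf⟩ := mem_subdifferential_iff.1 h
  refine mem_subdifferential_iff.2 ⟨pairing y u - a, ?_, fun q s hs => ?_⟩
  · refine le_antisymm ?_ ?_
    · rw [fitzpatrickConjT_le_iff]
      intro p r hr
      have := hf p r hr
      rw [pairing_sub_right, pairing_comm u, pairing_comm u] at this
      rw [Prod.swap_swap]
      linarith
    · refine le_of_eq_of_le ?_ (le_iSup _ y)
      rw [ha, Prod.swap_swap, EReal.coe_sub]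
  · have h1 := (fitzpatrickConjT_le_iff A q s).1 hs y a ha.le
    rw [← pairing_swap_swap, Prod.swap_swap] at h1
    rw [pairing_sub_right, pairing_swap_swap]
    linarith

/-! ### The maximally monotone extension -/

/-- The proximal points `y` of `f` and `z = v - J y` of `g` at a point `v = J v` average to a point
of the graph of `Ã`. -/
lemma mem_tildeOp_average {A : SetOp X} {v y : X × X} (hv : v.swap = v)
    (hy : v - y ∈ subdifferential (fitzpatrick A) y) :
    (1 / 2 : ℝ) • (y + (v - y.swap)) ∈ gra (tildeOp A) := by
  have hz : v - (v - y.swap) ∈ subdifferential (fitzpatrickConjT A) (v - y.swap) := by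
    have h1 := swap_mem_subdifferential_conjT hy
    have h2 : (v - y).swap = v - y.swap := by rw [Prod.swap_sub, hv]
    rwa [sub_sub_cancel, ← h2]
  have h := sub_mem_subdifferential_proxAverage hy hz
  have hw : v - (1 / 2 : ℝ) • (y + (v - y.swap)) =
      ((1 / 2 : ℝ) • (y + (v - y.swap))).swap := by
    have hs : ((1 / 2 : ℝ) • (y + (v - y.swap))).swap = (1 / 2 : ℝ) • (y + (v - y.swap)).swap := rfl
    rw [hs, Prod.swap_add, Prod.swap_sub, hv, Prod.swap_swap]
    module
  rw [hw] at h
  exact h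

lemma IsMonotone.subset_tildeOp {A : SetOp X} (hA : IsMonotone A) :
    gra A ⊆ gra (tildeOp A) := by
  intro a ha
  have h := mem_tildeOp_average (A := A) (v := a + a.swap) (y := a)
    (by rw [Prod.swap_add, Prod.swap_swap, add_comm])
    (by rw [add_sub_cancel_left]; exact hA.swap_mem_subdifferential ha)
  have hw : (1 / 2 : ℝ) • (a + (a + a.swap - a.swap)) = a := by module
  rwa [hw] at h

lemma isMonotone_tildeOp (A : SetOp X) : IsMonotone (tildeOp A) := by
  intro p hp q hq
  have h := subdifferential_monotone hp hq
  simp only [pairing, Prod.fst_sub, Prod.snd_sub] at h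
  rw [real_inner_comm] at h
  linarith

lemma fitzpatrickAffine_nonempty {A : SetOp X} (hne : (gra A).Nonempty) :
    (fitzpatrickAffine A).Nonempty :=
  hne.image _

lemma IsMonotone.conjTAffine_nonempty {A : SetOp X} (hA : IsMonotone A)
    (hne : (gra A).Nonempty) : (conjTAffine A).Nonempty := by
  obtain ⟨a, ha⟩ := hne
  refine ⟨(a.swap, inner ℝ a.1 a.2), ?_⟩
  simp only [conjTAffine, Set.mem_ofPred_eq, Prod.swap_swap]
  exact (hA.fitzpatrick_eq ha).le

/-- Surjectivity of `Id + Ã`. -/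
lemma IsMonotone.exists_sub_mem_tildeOp [CompleteSpace X] {A : SetOp X} (hA : IsMonotone A)
    (hne : (gra A).Nonempty) (u : X) : ∃ x, u - x ∈ tildeOp A x := by
  have hE : (affineEpi (fitzpatrickAffine A)).Nonempty := by
    obtain ⟨a, ha⟩ := hne
    exact ⟨(a, _), (isAffineSup_fitzpatrick A _ _).1 (hA.fitzpatrick_eq ha).le⟩
  obtain ⟨y, a, hya, hsub⟩ := exists_subgradient (fitzpatrickAffine_nonempty hne) hE (u, u)
  have hy : (u, u) - y ∈ subdifferential (fitzpatrick A) y := by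
    have hle := (isAffineSup_fitzpatrick A y a).2 hya
    refine mem_subdifferential_iff.2 ⟨a, le_antisymm hle ?_, fun q s hs =>
      hsub q s ((isAffineSup_fitzpatrick A q s).1 hs)⟩
    obtain ⟨α, hα⟩ := exists_coe_of_le
      ((isAffineSup_fitzpatrick A).ne_bot (fitzpatrickAffine_nonempty hne) y) hle
    have := hsub y α ((isAffineSup_fitzpatrick A y α).1 hα.le)
    rw [pairing_sub_right, sub_self, add_zero] at this
    rw [hα]
    exact_mod_cast this
  have h := mem_tildeOp_average (A := A) (v := (u, u)) rfl hy
  refine ⟨(1 / 2 : ℝ) • (y.1 + (u - y.2)), ?_⟩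
  have h2 : u - (1 / 2 : ℝ) • (y.1 + (u - y.2)) = (1 / 2 : ℝ) • (y.2 + (u - y.1)) := by module
  rw [h2]
  exact h

/-! ### The operators built from `T` -/

variable {S : Set X}

lemma mem_gra_stepA (T : S → X) (p : X × X) :
    p ∈ gra (stepA T) ↔ ∃ s : S, p = (stepF T s, s - stepF T s) := by
  simp only [gra, stepA, SetOp.sub, SetOp.inv, SetOp.ofMap, SetOp.id, Set.mem_ofPred_eq,
    Set.mem_singleton_iff]
  constructor
  · rintro ⟨a, ⟨ha, h1⟩, b, rfl, h2⟩
    exact ⟨⟨a, ha⟩, Prod.ext h1 (by rw [h2, ← h1])⟩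
  · rintro ⟨s, rfl⟩
    exact ⟨s, ⟨s.2, rfl⟩, _, rfl, rfl⟩

/-- `F` is firmly nonexpansive, which is monotonicity of `F⁻¹ - Id`. -/
lemma isMonotone_stepA {T : S → X} (hT : LipschitzWith 1 T) : IsMonotone (stepA T) := by
  intro p hp q hq
  obtain ⟨s, rfl⟩ := (mem_gra_stepA T p).1 hp
  obtain ⟨t, rfl⟩ := (mem_gra_stepA T q).1 hq
  have h : ‖T s - T t‖ ≤ ‖(s : X) - t‖ := by
    simpa [dist_eq_norm, Subtype.dist_eq] using hT.dist_le_mul s t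
  have h1 : stepF T s - stepF T t = (1 / 2 : ℝ) • (((s : X) - t) + (T s - T t)) := by
    simp only [stepF]; module
  have h2 : (s - stepF T s) - (t - stepF T t) =
      (1 / 2 : ℝ) • (((s : X) - t) - (T s - T t)) := by
    simp only [stepF]; module
  simp only [h1, h2]
  generalize (s : X) - t = d at h
  generalize T s - T t = e at h
  rw [real_inner_smul_left, real_inner_smul_right, inner_add_left, inner_sub_right,
    inner_sub_right, real_inner_self_eq_norm_sq, real_inner_self_eq_norm_sq,
    real_inner_comm e]
  nlinarith [norm_nonneg e]

lemma mem_stepTTilde_iff (T : S → X) (u t : X) :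
    t ∈ stepTTilde T u ↔ ∃ x, u - x ∈ tildeOp (stepA T) x ∧ t = (2 : ℝ) • x - u := by
  simp only [stepTTilde, stepFTilde, SetOp.sub, SetOp.smul, SetOp.inv, SetOp.add, SetOp.id,
    Set.mem_ofPred_eq, Set.mem_singleton_iff]
  constructor
  · rintro ⟨_, ⟨x, ⟨_, rfl, b, hb, rfl⟩, rfl⟩, _, rfl, rfl⟩
    exact ⟨_, by rwa [add_sub_cancel_left], rfl⟩
  · rintro ⟨x, hx, rfl⟩
    exact ⟨_, ⟨x, ⟨x, rfl, _, hx, by abel⟩, rfl⟩, u, rfl, rfl⟩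

/-- The reflected resolvent of a monotone operator is nonexpansive. -/
lemma IsMonotone.norm_reflectedResolvent_sub_le {B : SetOp X} (hB : IsMonotone B) {u v x y : X}
    (hx : u - x ∈ B x) (hy : v - y ∈ B y) :
    ‖((2 : ℝ) • x - u) - ((2 : ℝ) • y - v)‖ ≤ ‖u - v‖ := by
  have h := hB (x, u - x) hx (y, v - y) hy
  have h1 : (u - x) - (v - y) = (u - v) - (x - y) := by abel
  have h2 : ((2 : ℝ) • x - u) - ((2 : ℝ) • y - v) = (2 : ℝ) • (x - y) - (u - v) := by module
  simp only [h1] at h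
  rw [inner_sub_right, real_inner_self_eq_norm_sq] at h
  rw [h2]
  refine le_of_sq_le_sq ?_ (norm_nonneg _)
  rw [norm_sub_sq_real, norm_smul, real_inner_smul_left, Real.norm_ofNat]
  linarith

end KirszbraunExt

open KirszbraunExt in
theorem theorem3p1 {X : Type*} [NormedAddCommGroup X] [InnerProductSpace ℝ X] [CompleteSpace X]
    (S : Set X) (hS : S.Nonempty) (T : S → X) (hT : LipschitzWith 1 T) :
    (∀ w : X × X, IsLeast
      (KirszbraunExt.proxAverageValues (KirszbraunExt.fitzpatrick (KirszbraunExt.stepA T))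
        (KirszbraunExt.fitzpatrickConjT (KirszbraunExt.stepA T)) w)
      (KirszbraunExt.psi (KirszbraunExt.stepA T) w)) ∧
    ∃ T' : X → X,
      (∀ x : X, KirszbraunExt.stepTTilde T x = {T' x}) ∧
      LipschitzWith 1 T' ∧
      ∀ s : S, T' s = T s := by
  have hA := isMonotone_stepA hT
  have hne : (gra (stepA T)).Nonempty := by
    obtain ⟨s, hs⟩ := hS
    exact ⟨_, (mem_gra_stepA T _).2 ⟨⟨s, hs⟩, rfl⟩⟩
  refine ⟨isLeast_proxAverageValues (isAffineSup_fitzpatrick _) (isAffineSup_conjT _)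
    (fitzpatrickAffine_nonempty hne) (hA.conjTAffine_nonempty hne), ?_⟩
  have hM := isMonotone_tildeOp (stepA T)
  choose R hR using hA.exists_sub_mem_tildeOp hne
  have huniq : ∀ u x, u - x ∈ tildeOp (stepA T) x → (2 : ℝ) • x - u = (2 : ℝ) • R u - u := by
    intro u x hx
    have := hM.norm_reflectedResolvent_sub_le hx (hR u)
    rw [sub_self, norm_zero] at this
    exact sub_eq_zero.1 (norm_le_zero_iff.1 this)
  refine ⟨fun u => (2 : ℝ) • R u - u, fun u => ?_, ?_, fun s => ?_⟩
  · ext t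
    rw [mem_stepTTilde_iff, Set.mem_singleton_iff]
    exact ⟨fun ⟨x, hx, ht⟩ => ht.trans (huniq u x hx), fun ht => ⟨R u, hR u, ht⟩⟩
  · refine LipschitzWith.of_dist_le_mul fun u v => ?_
    rw [NNReal.coe_one, one_mul, dist_eq_norm, dist_eq_norm]
    exact hM.norm_reflectedResolvent_sub_le (hR u) (hR v)
  · have hs : (s : X) - stepF T s ∈ tildeOp (stepA T) (stepF T s) :=
      hA.subset_tildeOp ((mem_gra_stepA T _).2 ⟨s, rfl⟩)
    refine (huniq _ _ hs).symm.trans ?_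
    simp only [stepF]
    module
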